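/- **Setting.** Let $M$ be a model of true arithmetic (the complete first-order theory of $(\mathbb N;0,1,+,\cdot,\le)$), let $n\in M$ be a nonstandard element and $[n]=\{1,\dots,n\}$. A relation on $[n]$ is said to be *in* $M$ if it is coded by elements of $M$ (say by Gödel's beta function). For a finite language $L$, an $L$-structure $A_W$ on $[n]$ is given by an interpretation $W\in M$ of the symbols of $L$ (all its relations and graphs of functions are in $M$), and it always also interprets the constants $1,n$, the ordering $\le$ and the graphs $\oplus,\odot$ of addition and multiplication as inherited from $M$. For $m\ge 1$ every set $X\subseteq[m]$ codes a DNF formula $x_X$: with $\langle i,j\rangle=(i+j)^2+i$, it is the disjunction, over all $i$ with $\langle i,1\rangle\in X$, of the conjunctions of the atoms $p_v$ with $\langle i,2v\rangle\in X$ and the negated atoms $\neg p_v$ with $\langle i,2v+1\rangle\in X$ ($1\le v\le m$). A set $Z\subseteq [m]$ is the assignment making exactly the $p_v$ with $v\in Z$ true. A relation $Y\subseteq[m]^a$ codes the number $y<2^{m^a}$ whose binary digits equal to $1$ are at the positions (base-$m$ ranks) of the tuples in $Y$. Formulas are identified with natural numbers through a fixed standard binary encoding, $|x|$ is the binary length of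 $x$, and $TAUT\subseteq\mathbb N$ is the set of propositional tautologies in the DeMorgan language. Let $SAT(Z,X)$ be a first-order formula in the symbols $1,n,\le,\oplus,\odot$ that defines on each finite $[m]$, $m \geq 1$, the relation "the assignment $Z\subseteq[m]$ satisfies the DNF formula $x_X$". A set $F\subseteq[n]$ in $M$ is a tautology in $M$ if $SAT(Z,F)$ holds on $[n]$ for all $Z\subseteq[n]$ in $M$. A propositional proof system (PPS) is a polynomial time relation $P\subseteq\mathbb N\times\mathbb N$ such that $P(x,y)$ implies $x\in TAUT$, and each $x\in TAUT$ has some $y$ with $P(x,y)$. It is p-bounded if for some $k\ge1$ every $x\in TAUT$ has some $y$ with $P(x,y)$ and $|y|\le|x|^k$. Given a PPS $P$, for each $k\ge1$ let $\Theta_k(X,Y,Y')$ be any first-order formula in $1,n,\le,\oplus,\odot$ and relation variables $X$ (unary), $Y$, $Y'$ (of some arities) such that $\exists Y'\,\Theta_k(X,Y,Y')$ defines the relation $P(x,y)\wedge|y|\le|x|^k$ on $[m]$ for all sufficiently large finite $m$: for all $X\subseteq[m]$, the numbers coded by those $Y$ for which $\exists Y'\,\Theta_k(X,Y,Y')$ holds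 on $[m]$ are exactly the $y$ with $P(x_X,y)$ and $|y|\le|x_X|^k$. For $R\subseteq[n]$ (not necessarily in $M$) the expansion $(A_W,F,R)$ satisfies the $\Pi^1_1$ theory $T_3$ (for $k$, with $X:=F$, $Z:=R$) if * $\neg SAT(R,F)$, and * for all $X',Y,Y',Z'$: $\Theta_k(X',Y,Y')\rightarrow SAT(Z',X')$, where the quantified relations range over some family $\mathcal S$ of relations on $[n]$ that contains $R$ and all relations on $[n]$ that are in $M$ (the family of all relations on $[n]$ is allowed, but not required). **Claim 3.** Suppose that for every finite language $L$, every $L$-structure $A_W$ with universe $[n]$ and every standard $k\ge1$ there is a set $F\subseteq[n]$, $F\in M$, coding a DNF formula that is a tautology in $M$, such that $(A_W,F)$ has an expansion $(A_W,F,R)$ satisfying $T_3$. Then $P$ is not p-bounded. -/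

import Mathlib

open FirstOrder FirstOrder.Language

namespace PseudoExp

/-! ## Propositional formulas, tautologies, proof systems -/

/-- Propositional formulas in the DeMorgan language, with atoms indexed by `ℕ`. -/
inductive PropForm : Type
  | fls : PropForm
  | tru : PropForm
  | var : ℕ → PropForm
  | neg : PropForm → PropForm
  | conj : PropForm → PropForm → PropForm
  | disj : PropForm → PropForm → PropForm

namespace PropForm

/-- The truth value of a formula under an assignment. -/
def eval (v : ℕ → Prop) : PropForm → Prop
  | fls => False
  | tru => True
  | var i => v i
  | neg φ => ¬ φ.eval v
  | conj φ ψ => φ.eval v ∧ ψ.eval v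
  | disj φ ψ => φ.eval v ∨ ψ.eval v

/-- A formula written as a binary word: prefix notation, every symbol being three bits, and the
index of an atom being written in binary (each bit preceded by `true`, closed by `false`). -/
def word : PropForm → List Bool
  | fls => [false, false, false]
  | tru => [false, false, true]
  | neg φ => [false, true, false] ++ φ.word
  | conj φ ψ => [false, true, true] ++ (φ.word ++ ψ.word)
  | disj φ ψ => [true, false, false] ++ (φ.word ++ ψ.word)
  | var i => [true, false, true] ++ ((Nat.bits i).flatMap (fun b => [true, b]) ++ [false])

/-- The natural number identified with a formula: its binary digits, from the least significant
one, are the word of the formula followed by a leading `1`. -/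
def code (φ : PropForm) : ℕ := φ.word.foldr Nat.bit 1

/-- Iterated disjunction. -/
def bigDisj (l : List PropForm) : PropForm := l.foldr disj fls

/-- Iterated conjunction. -/
def bigConj (l : List PropForm) : PropForm := l.foldr conj tru

theorem eval_bigDisj (v : ℕ → Prop) (l : List PropForm) :
    (bigDisj l).eval v ↔ ∃ φ ∈ l, φ.eval v := by
  induction l with
  | nil => simp [bigDisj, eval]
  | cons a l ih => simp [bigDisj, eval] at ih ⊢; rw [ih]

theorem eval_bigConj (v : ℕ → Prop) (l : List PropForm) :
    (bigConj l).eval v ↔ ∀ φ ∈ l, φ.eval v := by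
  induction l with
  | nil => simp [bigConj, eval]
  | cons a l ih => simp [bigConj, eval] at ih ⊢; simp [ih]

theorem index_word_inj (l₁ l₂ : List Bool) (s t : List Bool)
    (h : (l₁.flatMap (fun b => [true, b]) ++ [false]) ++ s =
      (l₂.flatMap (fun b => [true, b]) ++ [false]) ++ t) : l₁ = l₂ ∧ s = t := by
  induction l₁ generalizing l₂ with
  | nil => cases l₂ <;> simp_all
  | cons a l ih =>
    cases l₂ with
    | nil => simp at h
    | cons b l' =>
      simp only [List.flatMap_cons, List.cons_append, List.nil_append, List.append_assoc,
        List.cons.injEq, true_and] at h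
      have := ih l' (by simpa using h.2)
      exact ⟨by rw [h.1, this.1], this.2⟩

theorem word_inj (φ ψ : PropForm) (s t : List Bool) (h : φ.word ++ s = ψ.word ++ t) :
    φ = ψ ∧ s = t := by
  induction φ generalizing ψ s t with
  | fls => cases ψ <;> simp_all [word]
  | tru => cases ψ <;> simp_all [word]
  | neg φ ih =>
    cases ψ <;> simp [word] at h
    have := ih _ _ _ h
    exact ⟨by rw [this.1], this.2⟩
  | conj φ₁ φ₂ ih₁ ih₂ =>
    cases ψ <;> simp [word] at h
    have h1 := ih₁ _ _ _ h
    have h2 := ih₂ _ _ _ h1.2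
    exact ⟨by rw [h1.1, h2.1], h2.2⟩
  | disj φ₁ φ₂ ih₁ ih₂ =>
    cases ψ <;> simp [word] at h
    have h1 := ih₁ _ _ _ h
    have h2 := ih₂ _ _ _ h1.2
    exact ⟨by rw [h1.1, h2.1], h2.2⟩
  | var i =>
    cases ψ with
    | var j =>
      have h1 := index_word_inj (Nat.bits i) (Nat.bits j) s t (by simpa [word] using h)
      refine ⟨?_, h1.2⟩
      rw [show i = j from ?_]
      have := congrArg (fun l => Nat.ofDigits 2 (l.map (fun b => cond b 1 0))) h1.1
      simpa [← Nat.digits_two_eq_bits, Nat.ofDigits_digits] using this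
    | _ => simp [word] at h

/-- Distinct formulas are identified with distinct numbers. -/
theorem code_injective : Function.Injective code := by
  have key : ∀ l₁ l₂ : List Bool, l₁.foldr Nat.bit 1 = l₂.foldr Nat.bit 1 → l₁ = l₂ := by
    have pos : ∀ l : List Bool, 0 < l.foldr Nat.bit 1 := by
      intro l
      induction l with
      | nil => simp
      | cons a l ih => simp only [List.foldr_cons, Nat.bit_val]; omega
    intro l₁
    induction l₁ with
    | nil =>
      intro l₂ h
      cases l₂ with
      | nil => rfl
      | cons b l =>
        have := pos l
        simp only [List.foldr_cons, List.foldr_nil, Nat.bit_val] at h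
        omega
    | cons a l ih =>
      intro l₂ h
      cases l₂ with
      | nil =>
        have := pos l
        simp only [List.foldr_cons, List.foldr_nil, Nat.bit_val] at h
        omega
      | cons b l' =>
        simp only [List.foldr_cons] at h
        have h1 := congrArg Nat.bodd h
        have h2 := congrArg Nat.div2 h
        rw [Nat.bodd_bit, Nat.bodd_bit] at h1
        rw [Nat.div2_bit, Nat.div2_bit] at h2
        rw [h1, ih _ h2]
  intro φ ψ h
  exact (word_inj φ ψ [] [] (by rw [key _ _ h])).1

end PropForm

/-- The set of (numbers of) propositional tautologies. -/
def TAUT : Set ℕ := {x | ∃ φ : PropForm, φ.code = x ∧ ∀ v : ℕ → Prop, φ.eval v}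

/-- A pair of numbers as a word for a Turing machine: the binary digits of both, separated by a
marker. -/
def pairWord (z : ℕ × ℕ) : List (Option Bool) :=
  (Nat.bits z.1).map some ++ none :: (Nat.bits z.2).map some

/-- A binary relation on `ℕ` is polynomial time if a Turing machine decides it in time polynomial
in the total binary length of the arguments. -/
def PolyTimeRel (P : ℕ → ℕ → Prop) : Prop :=
  ∃ f : ℕ × ℕ → Bool, (∀ x y, f (x, y) = true ↔ P x y) ∧
    Nonempty (Turing.TM2ComputableInPolyTime pairWord (fun b : Bool => [b]) f)

/-- Propositional proof systems in the sense of Cook and Reckhow. -/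
structure IsPPS (P : ℕ → ℕ → Prop) : Prop where
  polyTime : PolyTimeRel P
  sound : ∀ x y, P x y → x ∈ TAUT
  complete : ∀ x ∈ TAUT, ∃ y, P x y

/-- `P` is p-bounded: all tautologies `x` have proofs `y` with `|y| ≤ |x| ^ k`, for some fixed
`k ≥ 1`, where `|x|` is the binary length `Nat.size x`. -/
def PBounded (P : ℕ → ℕ → Prop) : Prop :=
  ∃ k : ℕ, 1 ≤ k ∧ ∀ x ∈ TAUT, ∃ y, P x y ∧ Nat.size y ≤ Nat.size x ^ k

/-! ## Models of true arithmetic -/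

/-- Function symbols `0, 1, +, ·`. -/
inductive ArithFunc : ℕ → Type
  | zero : ArithFunc 0
  | one : ArithFunc 0
  | add : ArithFunc 2
  | mul : ArithFunc 2

/-- The relation symbol `≤`. -/
inductive ArithRel : ℕ → Type
  | le : ArithRel 2

/-- The language `0, 1, +, ·, ≤` of arithmetic. -/
def arith : FirstOrder.Language.{0, 0} := ⟨ArithFunc, ArithRel⟩

/-- The symbol `0`. -/
abbrev zeroSym : arith.Functions 0 := ArithFunc.zero

/-- The symbol `1`. -/
abbrev oneSym : arith.Functions 0 := ArithFunc.one

/-- The symbol `+`. -/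
abbrev addSym : arith.Functions 2 := ArithFunc.add

/-- The symbol `·`. -/
abbrev mulSym : arith.Functions 2 := ArithFunc.mul

/-- The symbol `≤`. -/
abbrev leSym : arith.Relations 2 := ArithRel.le

/-- The standard model. -/
instance natArith : arith.Structure ℕ where
  funMap := fun {r} (f : ArithFunc r) =>
    match r, f with
    | _, .zero => fun _ => 0
    | _, .one => fun _ => 1
    | _, .add => fun t => t 0 + t 1
    | _, .mul => fun t => t 0 * t 1
  RelMap := fun {r} (R : ArithRel r) =>
    match r, R with
    | _, .le => fun t => t 0 ≤ t 1

/-- `M` is a model of true arithmetic, the complete theory of the standard model. -/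
class TrueArith (M : Type*) [arith.Structure M] : Prop where
  equiv : ℕ ≅[arith] M

instance : TrueArith ℕ := ⟨rfl⟩

section Model

variable {M : Type*} [arith.Structure M]

/-- The constant `0` of `M`. -/
def mzero : M := Structure.funMap zeroSym ![]

/-- The constant `1` of `M`. -/
def mone : M := Structure.funMap oneSym ![]

/-- Addition of `M`. -/
def madd (x y : M) : M := Structure.funMap addSym ![x, y]

/-- Multiplication of `M`. -/
def mmul (x y : M) : M := Structure.funMap mulSym ![x, y]

/-- The ordering of `M`. -/
def mle (x y : M) : Prop := Structure.RelMap leSym ![x, y]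

/-- The value of the numeral `j` in `M`. -/
def numeral : ℕ → M
  | 0 => mzero
  | j + 1 => madd (numeral j) mone

/-- An element is nonstandard if it is not the value of a numeral. -/
def Nonstandard (n : M) : Prop := ∀ j : ℕ, n ≠ numeral j

theorem mle_refl [TrueArith M] (x : M) : mle x x := by
  have h := (elementarilyEquivalent_iff.1 (TrueArith.equiv (M := M)))
    (∀' (leSym.boundedFormula₂ (&0) (&0)))
  simp only [Sentence.Realize, Formula.Realize, BoundedFormula.realize_all,
    BoundedFormula.realize_rel₂] at h
  exact h.1 (fun a => le_refl a) x

theorem mone_le [TrueArith M] {x : M} (hx : x ≠ mzero) : mle mone x := by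
  have h := (elementarilyEquivalent_iff.1 (TrueArith.equiv (M := M)))
    (∀' ((∼ (Term.bdEqual (&0) (Constants.term zeroSym))) ⟹
      leSym.boundedFormula₂ (Constants.term oneSym) (&0)))
  simp only [Sentence.Realize, Formula.Realize, BoundedFormula.realize_all,
    BoundedFormula.realize_rel₂, BoundedFormula.realize_imp, BoundedFormula.realize_not,
    BoundedFormula.realize_bdEqual, Term.realize_constants] at h
  have e : ∀ c : arith.Constants, (c : M) = Structure.funMap c ![] := fun c => by
    simp only [constantMap]
    congr 1
  have h2 := h.1 (fun a ha => Nat.one_le_iff_ne_zero.2 ha) x (fun e' => hx (e'.trans (e zeroSym)))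
  rw [e oneSym] at h2
  exact h2

theorem Nonstandard.mone_le [TrueArith M] {n : M} (hn : Nonstandard n) : mle mone n :=
  PseudoExp.mone_le (hn 0)

/-- The set `[n] = {1, …, n}` of `M`. -/
abbrev Seg (M : Type*) [arith.Structure M] (n : M) : Type _ := {x : M // mle mone x ∧ mle x n}

/-- `r`-ary relations on `U`. -/
abbrev RelOn (U : Type*) (r : ℕ) : Type _ := Set (Fin r → U)

end Model

/-! ## Structures on `[n]` -/

/-- Constants `1` and `n`. -/
inductive OrdFunc : ℕ → Type
  | one : OrdFunc 0
  | top : OrdFunc 0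

/-- The ordering and the graphs `⊕`, `⊙` of addition and multiplication. -/
inductive OrdRel : ℕ → Type
  | le : OrdRel 2
  | add : OrdRel 3
  | mul : OrdRel 3

/-- The language `1, n, ≤, ⊕, ⊙` that every structure on `[n]` interprets. -/
def ordArith : FirstOrder.Language.{0, 0} := ⟨OrdFunc, OrdRel⟩

/-- The structure that `[n]` inherits from `M`. -/
@[reducible]
def intervalStructure {M : Type*} [arith.Structure M] [TrueArith M] (n : M) (hn : mle mone n) :
    ordArith.Structure (Seg M n) where
  funMap := fun {r} (f : OrdFunc r) =>
    match r, f with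
    | _, .one => fun _ => ⟨mone, mle_refl _, hn⟩
    | _, .top => fun _ => ⟨n, hn, mle_refl _⟩
  RelMap := fun {r} (R : OrdRel r) =>
    match r, R with
    | _, .le => fun t => mle (t 0).1 (t 1).1
    | _, .add => fun t => madd (t 0).1 (t 1).1 = (t 2).1
    | _, .mul => fun t => mmul (t 0).1 (t 1).1 = (t 2).1

/-- An injective numbering of the `r`-tuples from `[n]` by elements of `M`
(bijective base-`n` numeration). -/
def tupleIndex {M : Type*} [arith.Structure M] (n : M) : {r : ℕ} → (Fin r → Seg M n) → M
  | 0, _ => mzero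
  | _ + 1, t => madd (t (Fin.last _)).1 (mmul n (tupleIndex n (fun i => t i.castSucc)))

/-- The relation `S` on `[n]` is an element of `M`: it is coded in `M`, by means of Gödel's
beta function; the pair `(a, b)` codes the set of all `i` such that `1 + (1 + i) b` divides `a`. -/
def Coded {M : Type*} [arith.Structure M] (n : M) {r : ℕ} (S : RelOn (Seg M n) r) : Prop :=
  ∃ a b : M, ∀ t : Fin r → Seg M n,
    t ∈ S ↔ ∃ q : M, a = mmul q (madd mone (mmul (madd mone (tupleIndex n t)) b))

/-- The language `L` is finite. -/
def FiniteLanguage (L : FirstOrder.Language.{0, 0}) : Prop :=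
  Finite (Σ r, L.Functions r) ∧ Finite (Σ r, L.Relations r)

/-- An interpretation `W` of a language on `[n]` is an element of `M`: the interpretations of all
relation symbols and the graphs of all functions are coded in `M`. -/
def CodedStructure {M : Type*} [arith.Structure M] (n : M) {L : FirstOrder.Language.{0, 0}}
    (W : L.Structure (Seg M n)) : Prop :=
  (∀ (r : ℕ) (Q : L.Relations r), Coded n {t | W.RelMap Q t}) ∧
    ∀ (r : ℕ) (f : L.Functions r),
      Coded n {t : Fin (r + 1) → Seg M n |
        t (Fin.last r) = W.funMap f (fun i => t i.castSucc)}

/-! ## Formulas with relation variables -/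

/-- The relation variables `Z, X` of the formula `SAT(Z, X)`. -/
inductive SatVar : ℕ → Type
  | Z : SatVar 1
  | X : SatVar 1

/-- The language consisting of the relation variables of `SAT(Z, X)`. -/
def satVars : FirstOrder.Language.{0, 0} := ⟨fun _ => Empty, SatVar⟩

/-- The values of the relation variables of `SAT(Z, X)`. -/
@[reducible]
def satStructure {U : Type*} (Z X : RelOn U 1) : satVars.Structure U where
  funMap := fun {_} f => Empty.elim f
  RelMap := fun {r} (V : SatVar r) =>
    match r, V with
    | _, .Z => fun t => t ∈ Z
    | _, .X => fun t => t ∈ X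

/-- The relation variables `X, Y, Y'` of `Θ(X, Y, Y')`, where `Y` is `a`-ary and `Y'` is
`b`-ary. -/
inductive ThetaVar (a b : ℕ) : ℕ → Type
  | X : ThetaVar a b 1
  | Y : ThetaVar a b a
  | Y' : ThetaVar a b b

/-- The language consisting of the relation variables of `Θ(X, Y, Y')`. -/
def thetaVars (a b : ℕ) : FirstOrder.Language.{0, 0} := ⟨fun _ => Empty, ThetaVar a b⟩

/-- The values of the relation variables of `Θ(X, Y, Y')`. -/
@[reducible]
def thetaStructure {U : Type*} {a b : ℕ} (X : RelOn U 1) (Y : RelOn U a) (Y' : RelOn U b) :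
    (thetaVars a b).Structure U where
  funMap := fun {_} f => Empty.elim f
  RelMap := fun {r} (V : ThetaVar a b r) =>
    match r, V with
    | _, .X => fun t => t ∈ X
    | _, .Y => fun t => t ∈ Y
    | _, .Y' => fun t => t ∈ Y'

/-- First-order formulas `SAT(Z, X)` in the language `1, n, ≤, ⊕, ⊙` of `[n]`. -/
abbrev SatFormula : Type := (ordArith.sum satVars).Sentence

/-- First-order formulas `Θ(X, Y, Y')` in the language `1, n, ≤, ⊕, ⊙` of `[n]`. -/
abbrev ThetaFormula (a b : ℕ) : Type := (ordArith.sum (thetaVars a b)).Sentence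

/-- A formula of the language `K` with relation variables `V` holds in the structure `A` when the
relation variables take the values `T`. -/
def Holds {U : Type*} {K V : FirstOrder.Language.{0, 0}} (A : K.Structure U) (T : V.Structure U)
    (φ : (K.sum V).Sentence) : Prop :=
  @Sentence.Realize (K.sum V) U (@FirstOrder.Language.sumStructure K V U A T) φ

/-- A formula in the language `1, n, ≤, ⊕, ⊙` seen as a formula in an extended language. -/
def extend (L : FirstOrder.Language.{0, 0}) {V : FirstOrder.Language.{0, 0}} (φ : (ordArith.sum V).Sentence) :
    ((ordArith.sum L).sum V).Sentence :=
  (LHom.sumMap (LHom.sumInl : ordArith →ᴸ ordArith.sum L) (LHom.id V)).onSentence φ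

/-! ## Coding of DNF formulas and of numbers by relations on `[m]` -/

/-- The number `p` belongs to the set `X ⊆ [m]`. -/
def Mem {m : ℕ} (X : RelOn (Seg ℕ m) 1) (p : ℕ) : Prop :=
  ∃ u : Seg ℕ m, u.1 = p ∧ (fun _ => u) ∈ X

/-- A pairing function on the positive integers, definable in all `[m]` with `⟨i, j⟩ ≤ m`. -/
def pr (i j : ℕ) : ℕ := (i + j) * (i + j) + i

open Classical in
/-- The `i`-th term of the DNF formula coded by `X ⊆ [m]`: the atom `v` occurs in it positively
if `⟨i, 2v⟩ ∈ X`, and negatively if `⟨i, 2v + 1⟩ ∈ X`. -/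
noncomputable def dnfTerm (m : ℕ) (X : RelOn (Seg ℕ m) 1) (i : ℕ) : PropForm :=
  PropForm.bigConj ((List.range' 1 m).flatMap (fun v =>
    (if Mem X (pr i (v + v)) then [PropForm.var v] else []) ++
    (if Mem X (pr i (v + v + 1)) then [PropForm.neg (PropForm.var v)] else [])))

open Classical in
/-- The DNF formula coded by `X ⊆ [m]`: the disjunction of the `i`-th terms over all `i` such that
`⟨i, 1⟩ ∈ X`. -/
noncomputable def dnf (m : ℕ) (X : RelOn (Seg ℕ m) 1) : PropForm :=
  PropForm.bigDisj (((List.range' 1 m).filter (fun i => Mem X (pr i 1))).map (dnfTerm m X))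

/-- The formula `SAT(Z, X)` defines in all finite `[m]` the satisfaction relation between
assignments `Z ⊆ [m]` and DNF formulas `X ⊆ [m]`. -/
def DefinesSat (Sat : SatFormula) : Prop :=
  ∀ (m : ℕ) (hm : 1 ≤ m) (Z X : RelOn (Seg ℕ m) 1),
    Holds (intervalStructure m hm) (satStructure Z X) Sat ↔ (dnf m X).eval (Mem Z)

/-- The position in `{0, …, m ^ r - 1}` of an `r`-tuple from `[m]` (base-`m` numeration). -/
def rank (m : ℕ) : {r : ℕ} → (Fin r → Seg ℕ m) → ℕ
  | 0, _ => 0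
  | _ + 1, t => ((t (Fin.last _)).1 - 1) + m * rank m (fun i => t i.castSucc)

/-- The relation `Y` on `[m]` codes the number (binary string) `y`, of length at most `m ^ r`:
the members of `Y` are the positions of the digits `1` of `y`. -/
def CodesNumber {m r : ℕ} (Y : RelOn (Seg ℕ m) r) (y : ℕ) : Prop :=
  Nat.size y ≤ m ^ r ∧ ∀ t, t ∈ Y ↔ y.testBit (rank m t) = true

/-- `∃ Y' Θ(X, Y, Y')` defines on `[m]`, for all large enough `m`, the relation
`P(x, y) ∧ |y| ≤ |x| ^ k` between DNF formulas `x` (coded by `X`) and numbers `y` (coded by `Y`):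
for each `X` the numbers coded by the relations `Y` such that `∃ Y' Θ(X, Y, Y')` are exactly the
numbers `y` with `P(x, y)` and `|y| ≤ |x| ^ k`. -/
def DefinesProof (P : ℕ → ℕ → Prop) (k : ℕ) {a b : ℕ} (Θ : ThetaFormula a b) : Prop :=
  ∃ m₀ : ℕ, ∀ (m : ℕ) (hm : 1 ≤ m), m₀ ≤ m → ∀ (X : RelOn (Seg ℕ m) 1) (y : ℕ),
    (P (dnf m X).code y ∧ Nat.size y ≤ Nat.size (dnf m X).code ^ k) ↔
      ∃ Y : RelOn (Seg ℕ m) a, CodesNumber Y y ∧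
        ∃ Y' : RelOn (Seg ℕ m) b,
          Holds (intervalStructure m hm) (thetaStructure X Y Y') Θ

/-! ## The theory `T₃` -/

/-- The DNF formula `F` is a tautology in `M`: in `M`, all assignments satisfy it. -/
def TautologyIn {M : Type*} [arith.Structure M] [TrueArith M] (n : M) (hn : mle mone n)
    (Sat : SatFormula) (F : RelOn (Seg M n) 1) : Prop :=
  ∀ Z : RelOn (Seg M n) 1, Coded n Z → Holds (intervalStructure n hn) (satStructure Z F) Sat

/-- The expansion `(A, F, R)` of the structure `A` satisfies the `Π¹₁` theory `T₃` with `X := F`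
and `Z := R`, where the relation quantifiers range over the relations in `𝒮`. The axioms are
`¬ SAT(Z, X)` and `∀ X', Y, Y', Z' (Θ(X', Y, Y') → SAT(Z', X'))`. -/
def ModelsT3 {U : Type*} {L : FirstOrder.Language.{0, 0}} (A : (ordArith.sum L).Structure U)
    (𝒮 : ∀ r, Set (RelOn U r)) (Sat : SatFormula) {a b : ℕ} (Θ : ThetaFormula a b)
    (F R : RelOn U 1) : Prop :=
  ¬ Holds A (satStructure R F) (extend L Sat) ∧
    ∀ X' ∈ 𝒮 1, ∀ Y ∈ 𝒮 a, ∀ Y' ∈ 𝒮 b, ∀ Z' ∈ 𝒮 1,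
      Holds A (thetaStructure X' Y Y') (extend L Θ) → Holds A (satStructure Z' X') (extend L Sat)

/-- The structure `A_W` on `[n]`, in the language `L` together with `1, n, ≤, ⊕, ⊙`. -/
abbrev structureAW {M : Type*} [arith.Structure M] [TrueArith M] (n : M) (hn : mle mone n)
    {L : FirstOrder.Language.{0, 0}} (W : L.Structure (Seg M n)) :
    (ordArith.sum L).Structure (Seg M n) :=
  @FirstOrder.Language.sumStructure ordArith L _ (intervalStructure n hn) W

/-! ## A formula defining satisfaction of DNF formulas -/

namespace SatWitness

abbrev kOne : (ordArith.sum satVars).Functions 0 := Sum.inl OrdFunc.one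
abbrev kAdd : (ordArith.sum satVars).Relations 3 := Sum.inl OrdRel.add
abbrev kMul : (ordArith.sum satVars).Relations 3 := Sum.inl OrdRel.mul
abbrev kZ : (ordArith.sum satVars).Relations 1 := Sum.inr SatVar.Z
abbrev kX : (ordArith.sum satVars).Relations 1 := Sum.inr SatVar.X

abbrev BF (n : ℕ) := (ordArith.sum satVars).BoundedFormula Empty n

/-- The pair `⟨i, j⟩` belongs to `X`. -/
def inX {n} (i j : Fin n) : BF n :=
  ∃' ∃' ∃' (kAdd.boundedFormula ![&(i.castSucc.castSucc.castSucc), &(j.castSucc.castSucc.castSucc),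
      &((Fin.last n).castSucc.castSucc)] ⊓
    kMul.boundedFormula ![&((Fin.last n).castSucc.castSucc), &((Fin.last n).castSucc.castSucc), &((Fin.last (n+1)).castSucc)] ⊓
    kAdd.boundedFormula ![&((Fin.last (n+1)).castSucc), &(i.castSucc.castSucc.castSucc), &(Fin.last (n+2))] ⊓
    kX.boundedFormula₁ (&(Fin.last (n+2))))

/-- An explicit formula `SAT(Z, X)`. -/
def satF : SatFormula :=
  (∃' ∃' ((Term.bdEqual (&1) (Constants.term kOne)) ⊓ inX 0 1 ⊓
   ∀' ((∀' (kAdd.boundedFormula ![&2, &2, &3] ⟹ (inX 0 3 ⟹ kZ.boundedFormula₁ (&2)))) ⊓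
       (∀' ∀' (kAdd.boundedFormula ![&2, &2, &3] ⟹ kAdd.boundedFormula ![&3, &1, &4] ⟹
          (inX 0 4 ⟹ ∼ (kZ.boundedFormula₁ (&2))))))) : BF 0)

section

variable {m : ℕ} (hm : 1 ≤ m) (Z X : RelOn (Seg ℕ m) 1)

@[reducible] def str : (ordArith.sum satVars).Structure (Seg ℕ m) :=
  @FirstOrder.Language.sumStructure ordArith satVars _ (intervalStructure m hm) (satStructure Z X)

theorem rl_add (t : Fin 3 → Seg ℕ m) :
   (str hm Z X).RelMap kAdd t ↔ (t 0).1 + (t 1).1 = (t 2).1 := Iff.rfl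
theorem rl_mul (t : Fin 3 → Seg ℕ m) :
   (str hm Z X).RelMap kMul t ↔ (t 0).1 * (t 1).1 = (t 2).1 := Iff.rfl
theorem rl_Z (t : Fin 1 → Seg ℕ m) :
   (str hm Z X).RelMap kZ t ↔ Mem Z (t 0).1 := by
  have : t = fun _ => t 0 := by ext i; rw [Subsingleton.elim i 0]
  constructor
  · intro h; exact ⟨t 0, rfl, this ▸ h⟩
  · rintro ⟨u, hu, h⟩
    rw [this, ← Subtype.ext hu]; exact h
theorem rl_X (t : Fin 1 → Seg ℕ m) :
   (str hm Z X).RelMap kX t ↔ Mem X (t 0).1 := by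
  have : t = fun _ => t 0 := by ext i; rw [Subsingleton.elim i 0]
  constructor
  · intro h; exact ⟨t 0, rfl, this ▸ h⟩
  · rintro ⟨u, hu, h⟩
    rw [this, ← Subtype.ext hu]; exact h
theorem mkSeg {m} (c : ℕ) (h : 1 ≤ c) (h' : c ≤ m) : ∃ u : Seg ℕ m, u.1 = c := ⟨⟨c, h, h'⟩, rfl⟩

theorem segLt {m} (u : Seg ℕ m) : u.1 < 1 + m := by
  have : u.1 ≤ m := u.2.2
  omega

theorem mem_le {m} {X : RelOn (Seg ℕ m) 1} {p} (h : Mem X p) : 1 ≤ p ∧ p ≤ m := by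
  obtain ⟨u, rfl, -⟩ := h
  exact u.2

theorem rl_inX {n} (i j : Fin n) (v) (xs : Fin n → Seg ℕ m) :
    @BoundedFormula.Realize _ _ (str hm Z X) _ _ (inX i j) v xs ↔ Mem X (pr (xs i).1 (xs j).1) := by
  let _ := str hm Z X
  simp only [inX, BoundedFormula.realize_ex, BoundedFormula.realize_inf, BoundedFormula.realize_rel, BoundedFormula.realize_rel₁, rl_add, rl_mul, rl_X]
  simp only [Matrix.cons_val_zero, Matrix.cons_val_one, Matrix.cons_val, Function.comp, Term.realize_var, Sum.elim_inr, Fin.snoc_castSucc, Fin.snoc_last]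
  constructor
  · rintro ⟨a, b, c, ⟨⟨h1, h2⟩, h3⟩, h4⟩
    rw [pr, h1, h2, h3]; exact h4
  · intro h
    have hb := mem_le h
    have hi : 1 ≤ (xs i).1 := (xs i).2.1
    have hs : (xs i).1 + (xs j).1 ≤ ((xs i).1 + (xs j).1) * ((xs i).1 + (xs j).1) := Nat.le_mul_self _
    unfold pr at hb h
    obtain ⟨u, hu⟩ := mkSeg (m := m) ((xs i).1 + (xs j).1) (by omega) (by omega)
    obtain ⟨w, hw⟩ := mkSeg (m := m) (((xs i).1 + (xs j).1) * ((xs i).1 + (xs j).1)) (by omega) (by omega)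
    obtain ⟨z, hz⟩ := mkSeg _ hb.1 hb.2
    exact ⟨u, w, z, ⟨⟨hu.symm, by rw [hu, hw]⟩, by rw [hw, hz]⟩, by rw [hz]; exact h⟩

/-- A formula defining satisfaction of DNF formulas exists. -/
theorem definesSat_satF : DefinesSat satF := by
  intro m hm Z X
  let _ := str hm Z X
  have e0 : ((Constants.term kOne).realize (L := ordArith.sum satVars) : (Empty ⊕ Fin 2 → Seg ℕ m) → Seg ℕ m) = fun _ => ⟨1, le_rfl, hm⟩ := rfl
  have L : Holds (intervalStructure m hm) (satStructure Z X) satF ↔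
     ∃ i : Seg ℕ m, Mem X (pr i.1 1) ∧ ∀ v : Seg ℕ m, (Mem X (pr i.1 (v.1+v.1)) → Mem Z v.1) ∧
      (Mem X (pr i.1 (v.1+v.1+1)) → ¬ Mem Z v.1) := by
    show @BoundedFormula.Realize _ _ (str hm Z X) _ _ satF _ _ ↔ _
    simp only [satF, BoundedFormula.realize_ex, BoundedFormula.realize_all, BoundedFormula.realize_inf, BoundedFormula.realize_imp, BoundedFormula.realize_not, BoundedFormula.realize_rel, BoundedFormula.realize_rel₁, rl_add, rl_Z, rl_inX, BoundedFormula.realize_bdEqual]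
    simp only [Matrix.cons_val_zero, Matrix.cons_val_one, Matrix.cons_val, Function.comp, Term.realize_var, Sum.elim_inr]
    simp [Fin.snoc]
    have hle : ∀ i j : Seg ℕ m, ∀ k, Mem X (pr i.1 k) → k ≤ m := by
      intro i j k h
      have := (mem_le h).2
      unfold pr at this
      have := Nat.le_mul_self (i.1 + k)
      omega
    have e1 : ((kOne : (ordArith.sum satVars).Constants) : Seg ℕ m) = ⟨1, le_rfl, hm⟩ := rfl
    have e2 : ∀ a b : ℕ, mle a b ↔ a ≤ b := fun _ _ => Iff.rfl
    have e3 : (mone : ℕ) = 1 := rfl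
    simp only [e1, e2, e3, Subtype.mk.injEq]
    constructor
    · rintro ⟨i, hi, j, ⟨⟨-, rfl⟩, h1⟩, h2⟩
      refine ⟨i, h1, hi, fun v h3 h4 => ?_⟩
      obtain ⟨h5, h6⟩ := h2 v h3 h4
      refine ⟨fun h => h5 (v + v) (by omega) (hle ⟨i, hi⟩ ⟨i, hi⟩ _ h) rfl h, fun h => ?_⟩
      have := hle ⟨i, hi⟩ ⟨i, hi⟩ _ h
      exact h6 (v + v) (by omega) (by omega) (v + v + 1) (by omega) this rfl rfl h
    · rintro ⟨i, h1, hi, h2⟩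
      refine ⟨i, hi, 1, ⟨⟨⟨le_rfl, hm⟩, rfl⟩, h1⟩, fun v h3 h4 => ⟨?_, ?_⟩⟩
      · rintro _ _ _ rfl h
        exact (h2 v h3 h4).1 h
      · rintro _ _ _ _ _ _ rfl rfl h
        exact (h2 v h3 h4).2 h
  rw [L]
  have T : ∀ i, (dnfTerm m X i).eval (Mem Z) ↔ ∀ v : Seg ℕ m,
      (Mem X (pr i (v.1+v.1)) → Mem Z v.1) ∧ (Mem X (pr i (v.1+v.1+1)) → ¬ Mem Z v.1) := by
    intro i
    simp only [dnfTerm, PropForm.eval_bigConj, List.mem_flatMap, List.mem_range'_1,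
      List.mem_append]
    constructor
    · intro h v
      have hv : 1 ≤ v.1 ∧ v.1 < 1 + m := ⟨v.2.1, segLt v⟩
      refine ⟨fun h1 => ?_, fun h1 => ?_⟩
      · exact h (.var v.1) ⟨v.1, hv, Or.inl (by simp [h1])⟩
      · exact h (.neg (.var v.1)) ⟨v.1, hv, Or.inr (by simp [h1])⟩
    · rintro h φ ⟨v, hv, h1 | h1⟩
      · split_ifs at h1 with h2
        · rw [List.mem_singleton.1 h1]
          exact (h ⟨v, hv.1, Nat.le_of_lt_succ (Nat.lt_of_lt_of_eq hv.2 (Nat.add_comm 1 m))⟩).1 h2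
        · simp at h1
      · split_ifs at h1 with h2
        · rw [List.mem_singleton.1 h1]
          exact (h ⟨v, hv.1, Nat.le_of_lt_succ (Nat.lt_of_lt_of_eq hv.2 (Nat.add_comm 1 m))⟩).2 h2
        · simp at h1
  simp only [dnf, PropForm.eval_bigDisj, List.mem_map, List.mem_filter, List.mem_range'_1,
    decide_eq_true_eq]
  constructor
  · rintro ⟨i, h1, h2⟩
    exact ⟨_, ⟨i.1, ⟨⟨i.2.1, segLt i⟩, h1⟩, rfl⟩, (T _).2 h2⟩
  · rintro ⟨_, ⟨i, ⟨hi, h1⟩, rfl⟩, h2⟩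
    exact ⟨⟨i, hi.1, Nat.le_of_lt_succ (Nat.lt_of_lt_of_eq hi.2 (Nat.add_comm 1 m))⟩, h1, (T _).1 h2⟩
end

end SatWitness

end PseudoExp

open PseudoExp

/-!
The argument is by transfer between the standard model and `M`. Suppose that `P` is p-bounded with
exponent `k`. Then, for all large `m`, every DNF tautology coded by a set `X ⊆ [m]` has a short
`P`-proof, and `DefinesProof` turns it into relations `Y, Y'` on `[m]` with `Θ(X, Y, Y')`. In the
standard model all relations on `[m]` are coded (`coded_nat`, the beta function lemma), so this is
a sentence of arithmetic with quantifiers over codes only, `completenessSentence`, and it belongs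
to true arithmetic (`realize_completenessSentence_nat`).

The sentence is therefore true in `M`. The nonstandard `n` exceeds every standard threshold
(`Nonstandard.numeral_mle`), so the tautology `F` of the hypothesis has coded `Y, Y'` with
`Θ(F, Y, Y')`. The relation quantifiers of `T₃` range over all coded relations and over `R`; hence
`T₃` yields `SAT(R, F)`, against its axiom `¬ SAT(R, F)`.

What makes the transfer possible is a syntactic translation `tr` of first-order formulas over `[n]`
with relation variables into formulas of arithmetic about `n` and codes of the relations. Its
correctness, `realize_tr`, holds uniformly in all models, in particular in `ℕ` and in `M`.
-/

namespace PseudoExp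

/-! ### Terms and transfer in models of true arithmetic -/

section Terms

variable {α : Type*}

/-- The term `0`. -/
def tmZero : arith.Term α := .func zeroSym ![]

/-- The term `1`. -/
def tmOne : arith.Term α := .func oneSym ![]

/-- The sum of two terms. -/
def tmAdd (s t : arith.Term α) : arith.Term α := addSym.apply₂ s t

/-- The product of two terms. -/
def tmMul (s t : arith.Term α) : arith.Term α := mulSym.apply₂ s t

/-- The term denoting the numeral of a natural number. -/
def tmNumeral : ℕ → arith.Term α
  | 0 => tmZero
  | j + 1 => tmAdd (tmNumeral j) tmOne

/-- The term denoting the index `tupleIndex` of a tuple of elements of `[m]`. -/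
def tmTupleIndex (m : arith.Term α) : {r : ℕ} → (Fin r → arith.Term α) → arith.Term α
  | 0, _ => tmZero
  | _ + 1, t => tmAdd (t (Fin.last _)) (tmMul m (tmTupleIndex m (fun i => t i.castSucc)))

variable {N : Type*} [arith.Structure N] (v : α → N)

@[simp] theorem realize_tmZero : (tmZero : arith.Term α).realize v = mzero :=
  congrArg (Structure.funMap zeroSym) (Subsingleton.elim _ _)

@[simp] theorem realize_tmOne : (tmOne : arith.Term α).realize v = mone :=
  congrArg (Structure.funMap oneSym) (Subsingleton.elim _ _)

@[simp] theorem realize_tmAdd (s t : arith.Term α) :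
    (tmAdd s t).realize v = madd (s.realize v) (t.realize v) :=
  Term.realize_functions_apply₂

@[simp] theorem realize_tmMul (s t : arith.Term α) :
    (tmMul s t).realize v = mmul (s.realize v) (t.realize v) :=
  Term.realize_functions_apply₂

@[simp] theorem realize_tmNumeral (j : ℕ) :
    (tmNumeral j : arith.Term α).realize v = numeral j := by
  induction j with
  | zero => simp [tmNumeral, numeral]
  | succ j ih => simp [tmNumeral, numeral, ih]

theorem realize_tmTupleIndex {n : N} {m : arith.Term α} (hm : m.realize v = n) {r : ℕ}
    (t : Fin r → arith.Term α) (u : Fin r → Seg N n) (h : ∀ i, (t i).realize v = (u i).1) :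
    (tmTupleIndex m t).realize v = tupleIndex n u := by
  induction r with
  | zero => simp [tmTupleIndex, tupleIndex]
  | succ r ih =>
    simp only [tmTupleIndex, tupleIndex, realize_tmAdd, realize_tmMul, hm, h]
    rw [ih _ (fun i => u i.castSucc) (fun i => h _)]

end Terms

theorem numeral_nat (j : ℕ) : (numeral j : ℕ) = j := by
  induction j with
  | zero => rfl
  | succ j ih => exact congrArg (· + 1) ih

/-- True arithmetic proves that `0` is the least element. -/
theorem mzero_mle {N : Type*} [arith.Structure N] [TrueArith N] (x : N) : mle mzero x := by
  have h := (elementarilyEquivalent_iff.1 (TrueArith.equiv (M := N)))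
    (∀' (leSym.boundedFormula₂ tmZero (&0)))
  simp only [Sentence.Realize, Formula.Realize, BoundedFormula.realize_all,
    BoundedFormula.realize_rel₂, realize_tmZero] at h
  exact h.1 (fun a => Nat.zero_le a) x

/-- True arithmetic proves that `x < y` implies `x + 1 ≤ y`. -/
theorem madd_one_mle {N : Type*} [arith.Structure N] [TrueArith N] {x y : N}
    (hxy : mle x y) (hne : x ≠ y) : mle (madd x mone) y := by
  have h := (elementarilyEquivalent_iff.1 (TrueArith.equiv (M := N)))
    (∀' ∀' (leSym.boundedFormula₂ (&0) (&1) ⟹ (∼ (Term.bdEqual (&0) (&1))) ⟹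
      leSym.boundedFormula₂ (tmAdd (&0) tmOne) (&1)))
  simp only [Sentence.Realize, Formula.Realize, BoundedFormula.realize_all,
    BoundedFormula.realize_rel₂, BoundedFormula.realize_imp, BoundedFormula.realize_not,
    BoundedFormula.realize_bdEqual, realize_tmAdd, realize_tmOne] at h
  refine h.1 (fun a b hab hn => ?_) x y hxy hne
  exact Nat.lt_of_le_of_ne hab hn

/-- A nonstandard element lies above all numerals. -/
theorem Nonstandard.numeral_mle {N : Type*} [arith.Structure N] [TrueArith N] {n : N}
    (hn : Nonstandard n) (j : ℕ) : mle (numeral j) n := by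
  induction j with
  | zero => exact mzero_mle n
  | succ j ih => exact madd_one_mle ih (hn j).symm

/-! ### Relations coded by pairs -/

/-- The `r`-ary relation on `[n]` coded by the pair `(a, b)`. -/
def decode {N : Type*} [arith.Structure N] (n a b : N) (r : ℕ) : RelOn (Seg N n) r :=
  {t | ∃ q : N, a = mmul q (madd mone (mmul (madd mone (tupleIndex n t)) b))}

theorem coded_iff_exists_decode {N : Type*} [arith.Structure N] {n : N} {r : ℕ}
    {S : RelOn (Seg N n) r} : Coded n S ↔ ∃ a b : N, S = decode n a b r :=
  exists_congr fun _ => exists_congr fun _ => Set.ext_iff.symm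

theorem coded_decode {N : Type*} [arith.Structure N] (n a b : N) (r : ℕ) :
    Coded n (decode n a b r) :=
  coded_iff_exists_decode.2 ⟨a, b, rfl⟩

theorem tupleIndex_nat_injective (m r : ℕ) :
    Function.Injective (tupleIndex m : (Fin r → Seg ℕ m) → ℕ) := by
  induction r with
  | zero => exact fun _ _ _ => Subsingleton.elim _ _
  | succ r ih =>
    intro s t h
    have h' : (s (Fin.last r)).1 + m * tupleIndex m (fun i => s i.castSucc) =
        (t (Fin.last r)).1 + m * tupleIndex m (fun i => t i.castSucc) := h
    have bounds : ∀ u : Seg ℕ m, 1 ≤ u.1 ∧ u.1 ≤ m := fun u => u.2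
    obtain ⟨hs1, hs2⟩ := bounds (s (Fin.last r))
    obtain ⟨ht1, ht2⟩ := bounds (t (Fin.last r))
    -- Two digits from `1, …, m` differ by less than `m`, whereas unequal remaining parts, being
    -- multiplied by `m`, would differ by at least `m`.
    have hq : tupleIndex m (fun i => s i.castSucc) = tupleIndex m (fun i => t i.castSucc) := by
      rcases lt_trichotomy (tupleIndex m (fun i => s i.castSucc))
        (tupleIndex m (fun i => t i.castSucc)) with hlt | heq | hlt
      · have := Nat.mul_le_mul_left m (Nat.succ_le_of_lt hlt)
        rw [Nat.succ_eq_add_one, mul_add] at this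
        omega
      · exact heq
      · have := Nat.mul_le_mul_left m (Nat.succ_le_of_lt hlt)
        rw [Nat.succ_eq_add_one, mul_add] at this
        omega
    have hd : s (Fin.last r) = t (Fin.last r) := Subtype.ext (by rw [hq] at h'; omega)
    funext i
    refine Fin.lastCases hd (fun j => ?_) i
    exact congrFun (ih hq) j

/-- In the standard model all relations on `[m]` are coded: this is Gödel's beta function lemma. -/
theorem coded_nat {m r : ℕ} (S : RelOn (Seg ℕ m) r) : Coded m S := by
  classical
  have : Finite (Seg ℕ m) :=
    Set.Finite.to_subtype ((Set.finite_Icc 1 m).subset fun x hx => hx)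
  have := Fintype.ofFinite (Fin r → Seg ℕ m)
  let idx : (Fin r → Seg ℕ m) → ℕ := tupleIndex m
  let B := Finset.univ.sup idx
  -- `b` is divisible by all differences of indices, which makes the moduli `md` coprime.
  let b := Nat.factorial B
  let md : (Fin r → Seg ℕ m) → ℕ := fun t => 1 + (1 + idx t) * b
  have hcop : ∀ s t, s ≠ t → Nat.Coprime (md s) (md t) := by
    have key : ∀ s t, idx s < idx t → Nat.Coprime (md s) (md t) := by
      intro s t hlt
      have hB : idx t ≤ B := Finset.le_sup (f := idx) (Finset.mem_univ t)
      have := Nat.coprime_mul_succ (n := 1 + idx s) (m := 1 + idx t) (a := b)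
        (Nat.dvd_factorial (by omega) (by omega))
      simpa only [md, add_comm 1] using this
    intro s t hne
    rcases lt_or_gt_of_ne ((tupleIndex_nat_injective m r).ne hne) with h | h
    · exact key s t h
    · exact (key t s h).symm
  -- By coprimality `md t` divides the product over `S` only if `t ∈ S`.
  refine ⟨∏ s ∈ Finset.univ.filter (· ∈ S), md s, b, fun t => ?_⟩
  have hdvd : (∃ q : ℕ, ∏ s ∈ Finset.univ.filter (· ∈ S), md s =
      mmul q (madd mone (mmul (madd mone (tupleIndex m t)) b))) ↔
      md t ∣ ∏ s ∈ Finset.univ.filter (· ∈ S), md s := by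
    rw [dvd_iff_exists_eq_mul_left]
    rfl
  rw [hdvd]
  constructor
  · exact fun ht => Finset.dvd_prod_of_mem md (by simpa using ht)
  · intro h
    by_contra ht
    have h1 : Nat.Coprime (md t) (∏ s ∈ Finset.univ.filter (· ∈ S), md s) :=
      Nat.Coprime.prod_right fun s hs => hcop t s (by rintro rfl; simp at hs; exact ht hs)
    have h2 : md t = 1 := Nat.Coprime.eq_one_of_dvd h1 h
    have h3 : 0 < (1 + idx t) * b := Nat.mul_pos (by omega) (Nat.factorial_pos B)
    simp only [md] at h2
    omega

/-! ### Translation of formulas over `[n]` into arithmetic -/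

section Translation

variable {ι : Type*} (top : ι) {V : FirstOrder.Language.{0, 0}} [V.IsRelational]
  (ca cb : ∀ {r : ℕ}, V.Relations r → ι)

/-- The translation of function symbols: `n` becomes the variable `top`. -/
def trFunc {r k : ℕ} : ordArith.Functions r ⊕ V.Functions r → arith.Term (ι ⊕ Fin k)
  | .inl OrdFunc.one => tmOne
  | .inl OrdFunc.top => .var (.inl top)
  | .inr f => isEmptyElim f

/-- The translation of terms. -/
def trTerm {k : ℕ} : (ordArith.sum V).Term (Empty ⊕ Fin k) → arith.Term (ι ⊕ Fin k)
  | .var (.inl e) => e.elim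
  | .var (.inr i) => .var (.inr i)
  | .func f _ => trFunc top f

/-- The arithmetic formula expressing that a tuple of elements of `[n]` belongs to the relation
coded by the values of the variables `a` and `b`. -/
def memDecode (a b : ι) {r k : ℕ} (t : Fin r → arith.Term (ι ⊕ Fin k)) :
    arith.BoundedFormula ι k :=
  ∃' (Term.bdEqual (.var (.inl a)) (tmMul (&(Fin.last k)) (tmAdd tmOne (tmMul (tmAdd tmOne
    (tmTupleIndex (.var (.inl top)) fun i => (t i).relabel (Sum.map id Fin.castSucc)))
      (.var (.inl b))))))

/-- The translation of atomic formulas. A relation variable `Q` becomes membership in the relation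
coded by the variables `ca Q` and `cb Q`. -/
def trRel {r k : ℕ} (t : Fin r → arith.Term (ι ⊕ Fin k)) :
    ordArith.Relations r ⊕ V.Relations r → arith.BoundedFormula ι k
  | .inl OrdRel.le => leSym.boundedFormula₂ (t 0) (t 1)
  | .inl OrdRel.add => Term.bdEqual (tmAdd (t 0) (t 1)) (t 2)
  | .inl OrdRel.mul => Term.bdEqual (tmMul (t 0) (t 1)) (t 2)
  | .inr Q => memDecode top (ca Q) (cb Q) t

/-- The translation of a formula with relation variables over `[n]` into a formula of arithmetic
about `n` (the variable `top`) and codes of the relations: quantifiers are relativized to `[n]`. -/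
def tr : {k : ℕ} → (ordArith.sum V).BoundedFormula Empty k → arith.BoundedFormula ι k
  | _, .falsum => ⊥
  | _, .equal s t => Term.bdEqual (trTerm top s) (trTerm top t)
  | _, .rel Q t => trRel top ca cb (fun i => trTerm top (t i)) Q
  | _, .imp φ ψ => tr φ ⟹ tr ψ
  | k, .all φ => ∀' (leSym.boundedFormula₂ tmOne (&(Fin.last k)) ⟹
      leSym.boundedFormula₂ (&(Fin.last k)) (.var (.inl top)) ⟹ tr φ)

variable {N : Type*} [arith.Structure N] (v : ι → N)

theorem realize_trTerm [TrueArith N] (hn : mle mone (v top))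
    (T : V.Structure (Seg N (v top))) {k : ℕ}
    (t : (ordArith.sum V).Term (Empty ⊕ Fin k)) (xs : Fin k → Seg N (v top)) :
    (trTerm top t).realize (Sum.elim v fun i => (xs i).1) =
      (@Term.realize _ _ (@FirstOrder.Language.sumStructure _ _ _
        (intervalStructure (v top) hn) T) _ (Sum.elim default xs) t).1 := by
  rcases t with (e | i) | ⟨f, ts⟩
  · exact e.elim
  · rfl
  · rcases f with f | f
    · cases f
      · exact realize_tmOne _
      · rfl
    · exact isEmptyElim f

theorem realize_memDecode (a b : ι) {r k : ℕ} (t : Fin r → arith.Term (ι ⊕ Fin k))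
    (xs : Fin k → N) (u : Fin r → Seg N (v top))
    (h : ∀ i, (t i).realize (Sum.elim v xs) = (u i).1) :
    (memDecode top a b t).Realize v xs ↔ u ∈ decode (v top) (v a) (v b) r := by
  simp only [memDecode, BoundedFormula.realize_ex, BoundedFormula.realize_bdEqual, realize_tmMul,
    realize_tmAdd, realize_tmOne, Term.realize_var, Sum.elim_inl, Sum.elim_inr, Function.comp,
    Fin.snoc_last]
  refine exists_congr fun q => ?_
  rw [realize_tmTupleIndex (n := v top) _ rfl _ u]
  intro i
  rw [Term.realize_relabel, ← h i]
  congr 1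
  ext (j | j) <;> simp

/-- The translation is correct, for relation variables with coded values. -/
theorem realize_tr [TrueArith N] (hn : mle mone (v top))
    (T : V.Structure (Seg N (v top)))
    (hT : ∀ (r : ℕ) (Q : V.Relations r) (u : Fin r → Seg N (v top)),
      T.RelMap Q u ↔ u ∈ decode (v top) (v (ca Q)) (v (cb Q)) r)
    {k : ℕ} (φ : (ordArith.sum V).BoundedFormula Empty k) (xs : Fin k → Seg N (v top)) :
    (tr top ca cb φ).Realize v (fun i => (xs i).1) ↔
      @BoundedFormula.Realize _ _ (@FirstOrder.Language.sumStructure _ _ _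
        (intervalStructure (v top) hn) T) _ _ φ default xs := by
  induction φ with
  | falsum => rfl
  | equal s t =>
    simp only [tr, BoundedFormula.realize_bdEqual, realize_trTerm top v hn T]
    exact Subtype.ext_iff.symm
  | rel Q t =>
    rcases Q with Q | Q
    · cases Q <;>
      simp only [tr, trRel, BoundedFormula.realize_rel₂, BoundedFormula.realize_bdEqual,
        realize_tmAdd, realize_tmMul, realize_trTerm top v hn T] <;> rfl
    · refine (realize_memDecode top v (ca Q) (cb Q) _ _ _
        fun i => realize_trTerm top v hn T (t i) xs).trans ?_
      exact (hT _ Q _).symm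
  | imp φ ψ ih₁ ih₂ =>
    simp only [tr, BoundedFormula.realize_imp, ih₁, ih₂]
  | all φ ih =>
    simp only [tr, BoundedFormula.realize_all, BoundedFormula.realize_imp,
      BoundedFormula.realize_rel₂, realize_tmOne, Term.realize_var, Sum.elim_inl, Sum.elim_inr,
      Function.comp, Fin.snoc_last]
    have e : ∀ x : Seg N (v top), (Fin.snoc (fun i => (xs i).1) x.1 : Fin _ → N) =
        fun i => ((Fin.snoc xs x : Fin _ → Seg N (v top)) i).1 := by
      intro x
      funext i
      refine Fin.lastCases ?_ (fun j => ?_) i <;> simp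
    constructor
    · intro h x
      have := h x.1 x.2.1 x.2.2
      rw [e] at this
      exact (ih _).1 this
    · intro h x h1 h2
      rw [e ⟨x, h1, h2⟩]
      exact (ih _).2 (h ⟨x, h1, h2⟩)

/-- The case of sentences, which is the one needed for transfer. -/
theorem realize_tr_sentence [TrueArith N] (hn : mle mone (v top)) (T : V.Structure (Seg N (v top)))
    (hT : ∀ (r : ℕ) (Q : V.Relations r) (u : Fin r → Seg N (v top)),
      T.RelMap Q u ↔ u ∈ decode (v top) (v (ca Q)) (v (cb Q)) r)
    (φ : (ordArith.sum V).Sentence) :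
    Formula.Realize (tr top ca cb φ) v ↔ Holds (intervalStructure (v top) hn) T φ := by
  rw [Formula.Realize, Subsingleton.elim (default : Fin 0 → N)
    (fun i => ((default : Fin 0 → Seg N (v top)) i).1)]
  exact realize_tr top ca cb v hn T hT φ default

end Translation

/-! ### Provability of coded tautologies as an arithmetic sentence -/

section Transfer

instance : satVars.IsRelational := fun _ => inferInstanceAs (IsEmpty Empty)

instance (a b : ℕ) : (thetaVars a b).IsRelational := fun _ => inferInstanceAs (IsEmpty Empty)

/-- The `i`-th component (`i = 0, 1`) of the code of a relation variable of `SAT(Z, X)`. The free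
variables `0, 1, 2` stand for `n` and the code of `X`, the bound ones for the code of `Z`. -/
def satCode (i : Fin 2) : {r : ℕ} → satVars.Relations r → Fin 3 ⊕ Fin 2
  | _, SatVar.Z => .inr i
  | _, SatVar.X => .inl i.succ

/-- The `i`-th component (`i = 0, 1`) of the code of a relation variable of `Θ(X, Y, Y')`. The free
variables `0, 1, 2` stand for `n` and the code of `X`, the bound ones for the codes of `Y` and
`Y'`. -/
def thetaCode (a b : ℕ) (i : Fin 2) :
    {r : ℕ} → (thetaVars a b).Relations r → Fin 3 ⊕ (Fin 2 ⊕ Fin 2)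
  | _, ThetaVar.X => .inl i.succ
  | _, ThetaVar.Y => .inr (.inl i)
  | _, ThetaVar.Y' => .inr (.inr i)

/-- The arithmetic formula `∀ Z, SAT(Z, X)`, with `Z` ranging over codes. -/
noncomputable def tautFormula (Sat : SatFormula) : arith.Formula (Fin 3) :=
  Formula.iAlls (Fin 2) (tr (.inl 0) (satCode 0) (satCode 1) Sat)

/-- The arithmetic formula `∃ Y Y', Θ(X, Y, Y')`, with `Y, Y'` ranging over codes. -/
noncomputable def provFormula {a b : ℕ} (Θ : ThetaFormula a b) : arith.Formula (Fin 3) :=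
  Formula.iExs (Fin 2 ⊕ Fin 2) (tr (.inl 0) (thetaCode a b 0) (thetaCode a b 1) Θ)

/-- The arithmetic sentence saying that for all `n ≥ m₀` with `n ≥ 1`, each coded `X ⊆ [n]` that is
satisfied by all coded assignments has coded `Y, Y'` with `Θ(X, Y, Y')`. -/
noncomputable def completenessSentence (Sat : SatFormula) {a b : ℕ} (Θ : ThetaFormula a b)
    (m₀ : ℕ) : arith.Sentence :=
  Formula.iAlls (Fin 3) (Formula.relabel Sum.inr
    ((leSym.formula₂ (tmNumeral m₀) (.var 0)) ⟹ (leSym.formula₂ tmOne (.var 0)) ⟹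
      tautFormula Sat ⟹ provFormula Θ))

variable {N : Type*} [arith.Structure N] [TrueArith N]

theorem realize_tautFormula (Sat : SatFormula) (v : Fin 3 → N) (hn : mle mone (v 0)) :
    (tautFormula Sat).Realize v ↔
      TautologyIn (v 0) hn Sat (decode (v 0) (v 1) (v 2) 1) := by
  have key : ∀ w : Fin 2 → N,
      Formula.Realize (tr (.inl 0) (satCode 0) (satCode 1) Sat) (Sum.elim v w) ↔ Holds (intervalStructure (v 0) hn)
        (satStructure (decode (v 0) (w 0) (w 1) 1) (decode (v 0) (v 1) (v 2) 1)) Sat := by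
    intro w
    exact realize_tr_sentence (Sum.inl 0) (satCode 0) (satCode 1) (Sum.elim v w) (hn : mle mone (v 0))
      (satStructure (U := Seg N (v 0)) (decode (v 0) (w 0) (w 1) 1) (decode (v 0) (v 1) (v 2) 1))
      (by rintro _ (_ | _) u <;> rfl) Sat
  rw [tautFormula, Formula.realize_iAlls]
  constructor
  · intro h Z hZ
    obtain ⟨c, d, rfl⟩ := coded_iff_exists_decode.1 hZ
    exact (key ![c, d]).1 (h _)
  · exact fun h w => (key w).2 (h _ (coded_decode _ _ _ _))

theorem realize_provFormula {a b : ℕ} (Θ : ThetaFormula a b) (v : Fin 3 → N)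
    (hn : mle mone (v 0)) :
    (provFormula Θ).Realize v ↔
      ∃ Y : RelOn (Seg N (v 0)) a, Coded (v 0) Y ∧ ∃ Y' : RelOn (Seg N (v 0)) b, Coded (v 0) Y' ∧
        Holds (intervalStructure (v 0) hn)
          (thetaStructure (decode (v 0) (v 1) (v 2) 1) Y Y') Θ := by
  have key : ∀ w : Fin 2 ⊕ Fin 2 → N,
      Formula.Realize (tr (.inl 0) (thetaCode a b 0) (thetaCode a b 1) Θ) (Sum.elim v w) ↔
      Holds (intervalStructure (v 0) hn)
        (thetaStructure (decode (v 0) (v 1) (v 2) 1)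
          (decode (v 0) (w (.inl 0)) (w (.inl 1)) a)
          (decode (v 0) (w (.inr 0)) (w (.inr 1)) b)) Θ := by
    intro w
    exact realize_tr_sentence (Sum.inl 0) (thetaCode a b 0) (thetaCode a b 1) (Sum.elim v w)
      (hn : mle mone (v 0))
      (thetaStructure (U := Seg N (v 0)) (decode (v 0) (v 1) (v 2) 1)
        (decode (v 0) (w (.inl 0)) (w (.inl 1)) a) (decode (v 0) (w (.inr 0)) (w (.inr 1)) b))
      (by rintro _ (_ | _ | _) u <;> rfl) Θ
  rw [provFormula, Formula.realize_iExs]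
  constructor
  · rintro ⟨w, h⟩
    exact ⟨_, coded_decode _ _ _ _, _, coded_decode _ _ _ _, (key w).1 h⟩
  · rintro ⟨Y, hY, Y', hY', h⟩
    obtain ⟨c, d, rfl⟩ := coded_iff_exists_decode.1 hY
    obtain ⟨c', d', rfl⟩ := coded_iff_exists_decode.1 hY'
    exact ⟨Sum.elim ![c, d] ![c', d'], (key _).2 h⟩

theorem realize_completenessSentence (Sat : SatFormula) {a b : ℕ} (Θ : ThetaFormula a b)
    (m₀ : ℕ) :
    N ⊨ completenessSentence Sat Θ m₀ ↔
      ∀ (n : N) (hn : mle mone n), mle (numeral m₀) n → ∀ X : RelOn (Seg N n) 1, Coded n X →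
        TautologyIn n hn Sat X →
          ∃ Y : RelOn (Seg N n) a, Coded n Y ∧ ∃ Y' : RelOn (Seg N n) b, Coded n Y' ∧
            Holds (intervalStructure n hn) (thetaStructure X Y Y') Θ := by
  rw [completenessSentence, Sentence.Realize, Formula.realize_iAlls]
  simp only [Formula.realize_relabel, Formula.realize_imp, Formula.realize_rel₂,
    realize_tmNumeral, realize_tmOne, Term.realize_var, Function.comp_def, Sum.elim_inr]
  constructor
  · intro h n hn hm X hX hT
    obtain ⟨c, d, rfl⟩ := coded_iff_exists_decode.1 hX
    exact (realize_provFormula Θ ![n, c, d] hn).1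
      (h ![n, c, d] hm hn ((realize_tautFormula Sat ![n, c, d] hn).2 hT))
  · intro h v hm hn hT
    exact (realize_provFormula Θ v hn).2
      (h (v 0) hn hm _ (coded_decode _ _ _ _) ((realize_tautFormula Sat v hn).1 hT))

end Transfer

/-! ### Tautologies coded in the standard model -/

/-- The truth value of a coded DNF formula depends on the atoms `1, …, m` only. -/
theorem eval_dnf_congr {m : ℕ} (X : RelOn (Seg ℕ m) 1) {v w : ℕ → Prop}
    (h : ∀ i, 1 ≤ i → i ≤ m → (v i ↔ w i)) : (dnf m X).eval v → (dnf m X).eval w := by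
  simp only [dnf, PropForm.eval_bigDisj, List.mem_map]
  rintro ⟨_, ⟨i, hi, rfl⟩, hv⟩
  refine ⟨_, ⟨i, hi, rfl⟩, ?_⟩
  simp only [dnfTerm, PropForm.eval_bigConj, List.mem_flatMap, List.mem_range'_1,
    List.mem_append] at hv ⊢
  rintro φ ⟨j, hj, hφ⟩
  have hjv := hv φ ⟨j, hj, hφ⟩
  have hvw := h j hj.1 (by omega)
  rcases hφ with hφ | hφ
  · split_ifs at hφ
    · rw [List.mem_singleton.1 hφ] at hjv ⊢
      exact hvw.1 hjv
    · simp at hφ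
  · split_ifs at hφ
    · rw [List.mem_singleton.1 hφ] at hjv ⊢
      exact fun hw => hjv (hvw.2 hw)
    · simp at hφ

/-- A tautology in the standard model is a propositional tautology, as all assignments are
coded. -/
theorem TautologyIn.code_mem_TAUT {Sat : SatFormula} (hSat : DefinesSat Sat) {m : ℕ} {hm : 1 ≤ m}
    {X : RelOn (Seg ℕ m) 1} (hX : TautologyIn m hm Sat X) : (dnf m X).code ∈ TAUT := by
  refine ⟨_, rfl, fun v => ?_⟩
  refine eval_dnf_congr X (fun i h1 h2 => ?_)
    ((hSat m hm {t | v (t 0).1} X).1 (hX _ (coded_nat _)))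
  exact ⟨by rintro ⟨u, rfl, h⟩; exact h, fun h => ⟨⟨i, h1, h2⟩, rfl, h⟩⟩

/-- If `P` is p-bounded with exponent `k`, then the sentence expressing this on coded DNF formulas
belongs to true arithmetic. -/
theorem realize_completenessSentence_nat {P : ℕ → ℕ → Prop} {k : ℕ}
    (hP : ∀ x ∈ TAUT, ∃ y, P x y ∧ Nat.size y ≤ Nat.size x ^ k)
    {Sat : SatFormula} (hSat : DefinesSat Sat) {a b : ℕ} {Θ : ThetaFormula a b}
    (hΘ : DefinesProof P k Θ) : ∃ m₀, ℕ ⊨ completenessSentence Sat Θ m₀ := by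
  obtain ⟨m₀, hm₀⟩ := hΘ
  refine ⟨m₀, (realize_completenessSentence Sat Θ m₀).2 fun m hm hle X _ hX => ?_⟩
  rw [numeral_nat] at hle
  obtain ⟨y, hy⟩ := hP _ (hX.code_mem_TAUT hSat)
  obtain ⟨Y, -, Y', h⟩ := (hm₀ m hm hle X y).1 hy
  exact ⟨Y, coded_nat Y, Y', coded_nat Y', h⟩

theorem holds_extend_iff {U : Type*} {L V : FirstOrder.Language.{0, 0}} (A : ordArith.Structure U)
    (W : L.Structure U) (T : V.Structure U) (φ : (ordArith.sum V).Sentence) :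
    Holds (@FirstOrder.Language.sumStructure ordArith L U A W) T (extend L φ) ↔ Holds A T φ :=
  LHom.realize_onSentence U _ φ

theorem finiteLanguage_empty : FiniteLanguage Language.empty :=
  have : IsEmpty (Σ r, Language.empty.Functions r) := ⟨fun x => isEmptyElim x.2⟩
  have : IsEmpty (Σ r, Language.empty.Relations r) := ⟨fun x => isEmptyElim x.2⟩
  ⟨inferInstance, inferInstance⟩

end PseudoExp

theorem claim3 {M : Type*} [arith.Structure M] [TrueArith M] (n : M) (hn : Nonstandard n)
    (P : ℕ → ℕ → Prop) (hP : IsPPS P)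
    (Sat : SatFormula) (hSat : DefinesSat Sat)
    (a b : ℕ → ℕ) (Θ : ∀ k, ThetaFormula (a k) (b k))
    (hΘ : ∀ k, 1 ≤ k → DefinesProof P k (Θ k))
    (H : ∀ L : FirstOrder.Language.{0, 0}, FiniteLanguage L →
      ∀ W : L.Structure (Seg M n), CodedStructure n W →
      ∀ k : ℕ, 1 ≤ k →
      ∃ F : RelOn (Seg M n) 1, Coded n F ∧ TautologyIn n hn.mone_le Sat F ∧
      ∃ (R : RelOn (Seg M n) 1) (𝒮 : ∀ r, Set (RelOn (Seg M n) r)),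
        (∀ (r : ℕ) (S : RelOn (Seg M n) r), Coded n S → S ∈ 𝒮 r) ∧ R ∈ 𝒮 1 ∧
        ModelsT3 (structureAW n hn.mone_le W) 𝒮 Sat (Θ k) F R) :
    ¬ PBounded P := by
  rintro ⟨k, hk, hbound⟩
  -- The empty language suffices: only `F`, `R` and the coded relations matter.
  obtain ⟨m₀, hm₀⟩ := realize_completenessSentence_nat hbound hSat (hΘ k hk)
  have hM : M ⊨ completenessSentence Sat (Θ k) m₀ :=
    (elementarilyEquivalent_iff.1 (TrueArith.equiv (M := M)) _).1 hm₀
  obtain ⟨F, hF, hFtaut, R, 𝒮, h𝒮, hR, hnot, hax⟩ :=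
    H Language.empty
      finiteLanguage_empty Language.emptyStructure ⟨fun _ Q => Q.elim, fun _ f => f.elim⟩ k hk
  obtain ⟨Y, hY, Y', hY', hprov⟩ := (realize_completenessSentence Sat (Θ k) m₀).1 hM n hn.mone_le
    (hn.numeral_mle m₀) F hF hFtaut
  exact hnot (hax F (h𝒮 1 F hF) Y (h𝒮 _ Y hY) Y' (h𝒮 _ Y' hY') R hR
    ((holds_extend_iff _ _ _ _).2 hprov))
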